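/- Let $G$ be a group and $\theta\colon G\to G$ a homomorphism. The Reilly semigroup (bisimple inverse $\omega$-semigroup) $\mathbf{B}(G,\theta)$ is the set $\mathbb{N}_0\times G\times\mathbb{N}_0$, where $\mathbb{N}_0=\{0,1,2,\dots\}$, with the multiplication $$(i,s,j)\cdot(m,t,n)=\bigl(i+m-d,\ \theta^{\,m-d}(s)\,\theta^{\,j-d}(t),\ j+n-d\bigr),\qquad d=\min\{j,m\},$$ where $\theta^0$ is the identity map; it is a monoid with identity $(0,1_G,0)$ and group of units $\{(0,g,0): g\in G\}\cong G$. Let $S=\mathbf{B}(G,\theta)^I=\mathbf{B}(G,\theta)\sqcup I$ be a semigroup that is the disjoint union of a subsemigroup (isomorphic to, and identified with) $\mathbf{B}(G,\theta)$ and a two-sided ideal $I$ of $S$. Let $\tau$ be a Hausdorff locally compact topology on $S$ for which the multiplication of $S$ is separately continuous. Suppose that the group of units of $\mathbf{B}(G,\theta)$ and the ideal $I$ are compact subsets of $(S,\tau)$. Then $(S,\tau)$ is compact or $I$ is open in $(S,\tau)$. -/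

import Mathlib

/-- The underlying set `ℕ × G × ℕ` of the Reilly semigroup `B(G, θ)`, that is, of the
Bruck–Reilly extension of the group `G` by the endomorphism `θ`. -/
@[ext]
structure ReillySemigroup {G : Type*} [Group G] (θ : G →* G) where
  /-- the first (row) index -/
  row : ℕ
  /-- the group component -/
  elt : G
  /-- the second (column) index -/
  col : ℕ

namespace ReillySemigroup

variable {G : Type*} [Group G] {θ : G →* G}

/-- `(i, s, j) * (m, t, n) = (i + m - d, θ^(m - d) s * θ^(j - d) t, j + n - d)` with
`d = min j m`, and `θ^0` the identity map. -/
instance : Mul (ReillySemigroup θ) where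
  mul x y :=
    ⟨x.row + y.row - min x.col y.row,
      (⇑θ)^[y.row - min x.col y.row] x.elt * (⇑θ)^[x.col - min x.col y.row] y.elt,
      x.col + y.col - min x.col y.row⟩

instance : One (ReillySemigroup θ) where
  one := ⟨0, 1, 0⟩

theorem mul_def (x y : ReillySemigroup θ) :
    x * y = ⟨x.row + y.row - min x.col y.row,
      (⇑θ)^[y.row - min x.col y.row] x.elt * (⇑θ)^[x.col - min x.col y.row] y.elt,
      x.col + y.col - min x.col y.row⟩ := rfl

theorem one_def : (1 : ReillySemigroup θ) = ⟨0, 1, 0⟩ := rfl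

/-- `B(G, θ)` is a monoid with identity `(0, 1, 0)`. -/
instance : Monoid (ReillySemigroup θ) where
  mul_assoc := by
    rintro ⟨i, s, j⟩ ⟨m, t, n⟩ ⟨k, u, l⟩
    simp only [mul_def, iterate_map_mul, ← Function.iterate_add_apply, mk.injEq]
    refine ⟨by omega, ?_, by omega⟩
    have h₁ : k - min (j + n - min j m) k + (m - min j m) =
        m + k - min n k - min j (m + k - min n k) := by omega
    have h₂ : k - min (j + n - min j m) k + (j - min j m) =
        j - min j (m + k - min n k) + (k - min n k) := by omega
    have h₃ : j + n - min j m - min (j + n - min j m) k =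
        j - min j (m + k - min n k) + (n - min n k) := by omega
    rw [mul_assoc, h₁, h₂, h₃]
  one_mul := by
    rintro ⟨i, s, j⟩
    simp [mul_def, one_def]
  mul_one := by
    rintro ⟨i, s, j⟩
    simp [mul_def, one_def]

end ReillySemigroup

/-- `I` is a (two-sided) ideal of the semigroup `S`: `S I ⊆ I` and `I S ⊆ I`. -/
def IsTwoSidedSemigroupIdeal {S : Type*} [Semigroup S] (I : Set S) : Prop :=
  ∀ x ∈ I, ∀ s : S, s * x ∈ I ∧ x * s ∈ I

/-- `S = B(G, θ) ⊔ I`: the map `ι` is an isomorphism of `B(G, θ)` onto a subsemigroup of `S`,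
and `S` is the disjoint union of this copy of `B(G, θ)` and of the two-sided ideal `I`. -/
structure IsReillyWithAdjoinedIdeal {G : Type*} [Group G] (θ : G →* G) {S : Type*} [Semigroup S]
    (ι : ReillySemigroup θ →ₙ* S) (I : Set S) : Prop where
  injective : Function.Injective ι
  isIdeal : IsTwoSidedSemigroupIdeal I
  disjoint : Disjoint (Set.range ι) I
  union_eq : Set.range ι ∪ I = Set.univ

/-!
Write `cell i j` for the copy in `S` of `{i} × G × {j}`. The cell `(0, 0)` is the group of units,
hence compact, and it is open: its complement is the union of `I` and of the fixed-point sets of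
left and right multiplication by the idempotent `(1, 1, 1)`. Translations carry both properties
over to every cell. So for a compact neighbourhood `K` of `I` and any neighbourhood `V` of `I`, the
compact set `K \ V` meets only finitely many cells (`exists_box_of_subset_open`), and therefore a
continuous self-map of `S` that preserves `I` maps `K` into `K` outside finitely many cells
(`exists_box_of_map`).

Apply this to left and right multiplication by `(1, 1, 0)` and `(0, 1, 1)`. For fixed `g` they move
`(i, g, j)` to its neighbours in the grid `ℕ × ℕ`, and the complement of the box `[0, N] × [0, N]`
in this grid is connected. Hence, outside a box that does not depend on `g`, either all points
`(i, g, j)` lie in `K` or none does. If `I` is not open, the first case occurs for some `g`. Left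
multiplication by a unit `(0, h, 0)` sends `(0, g, n)` to `(0, h * g, n)`, so the first case then
occurs for every element of `G`. Thus `K` contains all but finitely many cells, and `S` is compact.
-/

/-! ### Multiplication in the Reilly semigroup -/

namespace ReillySemigroup

variable {G : Type*} [Group G] {θ : G →* G}

theorem isUnit_iff {x : ReillySemigroup θ} : IsUnit x ↔ x.row = 0 ∧ x.col = 0 := by
  constructor
  · rintro ⟨u, rfl⟩
    have h₁ := congrArg row u.mul_inv
    have h₂ := congrArg col u.inv_mul
    simp only [mul_def, one_def] at h₁ h₂
    omega
  · obtain ⟨i, g, j⟩ := x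
    rintro ⟨rfl, rfl⟩
    exact ⟨⟨⟨0, g, 0⟩, ⟨0, g⁻¹, 0⟩, by simp [mul_def, one_def], by simp [mul_def, one_def]⟩, rfl⟩

theorem raise_row (i j : ℕ) (g : G) :
    (⟨1, 1, 0⟩ : ReillySemigroup θ) * ⟨i, g, j⟩ = ⟨i + 1, g, j⟩ := by
  simp [mul_def, add_comm]

theorem lower_row (i j : ℕ) (g : G) :
    (⟨0, 1, 1⟩ : ReillySemigroup θ) * ⟨i + 1, g, j⟩ = ⟨i, g, j⟩ := by
  simp [mul_def, add_comm]

theorem raise_col (i j : ℕ) (g : G) :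
    (⟨i, g, j⟩ : ReillySemigroup θ) * ⟨0, 1, 1⟩ = ⟨i, g, j + 1⟩ := by
  simp [mul_def]

theorem lower_col (i j : ℕ) (g : G) :
    (⟨i, g, j + 1⟩ : ReillySemigroup θ) * ⟨1, 1, 0⟩ = ⟨i, g, j⟩ := by
  simp [mul_def, add_comm]

theorem unit_mul_of_row_zero (j : ℕ) (h g : G) :
    (⟨0, h, 0⟩ : ReillySemigroup θ) * ⟨0, g, j⟩ = ⟨0, h * g, j⟩ := by
  simp [mul_def]

theorem translate_unit (i j : ℕ) (g : G) :
    (⟨i, 1, 0⟩ : ReillySemigroup θ) * ⟨0, g, 0⟩ * ⟨0, 1, j⟩ = ⟨i, g, j⟩ := by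
  simp [mul_def]

theorem translate_to_unit (i j : ℕ) (g : G) :
    (⟨0, 1, i⟩ : ReillySemigroup θ) * ⟨i, g, j⟩ * ⟨j, 1, 0⟩ = ⟨0, g, 0⟩ := by
  simp [mul_def]

/-- The translation that carries `(i, g, j)` to the unit `(0, g, 0)` produces a unit only from
elements with indices of the form `(i - k, j - k)`. -/
theorem le_of_isUnit_translate {i j : ℕ} {x : ReillySemigroup θ}
    (h : IsUnit (⟨0, 1, i⟩ * x * ⟨j, 1, 0⟩)) : x.row ≤ i ∧ x.col ≤ j ∧ x.row + j = x.col + i := by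
  rw [isUnit_iff] at h
  simp only [mul_def] at h
  omega

theorem idempotent_mul_eq_self_iff {x : ReillySemigroup θ} :
    (⟨1, 1, 1⟩ : ReillySemigroup θ) * x = x ↔ 1 ≤ x.row := by
  constructor
  · intro h
    have := congrArg row h
    simp only [mul_def] at this
    omega
  · obtain ⟨i, g, j⟩ := x
    intro h
    obtain ⟨k, rfl⟩ : ∃ k, i = k + 1 := ⟨i - 1, by simp only at h; omega⟩
    simp [mul_def, add_comm]

theorem mul_idempotent_eq_self_iff {x : ReillySemigroup θ} :
    x * (⟨1, 1, 1⟩ : ReillySemigroup θ) = x ↔ 1 ≤ x.col := by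
  constructor
  · intro h
    have := congrArg col h
    simp only [mul_def] at this
    omega
  · obtain ⟨i, g, j⟩ := x
    intro h
    obtain ⟨k, rfl⟩ : ∃ k, j = k + 1 := ⟨j - 1, by simp only at h; omega⟩
    simp [mul_def]

/-! ### Connectedness of the grid outside a box -/

/-- If `P` passes to grid neighbours from every point outside the box `[0, N] × [0, N]` and holds at
some point outside this box, then it holds everywhere outside the box. -/
theorem forall_outside_box {P : ℕ → ℕ → Prop} {N : ℕ}
    (up₁ : ∀ i j, N < max i j → P i j → P (i + 1) j)
    (down₁ : ∀ i j, N < max (i + 1) j → P (i + 1) j → P i j)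
    (up₂ : ∀ i j, N < max i j → P i j → P i (j + 1))
    (down₂ : ∀ i j, N < max i (j + 1) → P i (j + 1) → P i j)
    {i j : ℕ} (hij : N < max i j) (h : P i j) (p q : ℕ) (hpq : N < max p q) : P p q := by
  have right : ∀ k, P (i + k) j := by
    intro k
    induction k with
    | zero => exact h
    | succ k ih => exact up₁ (i + k) j (by omega) ih
  have far : ∀ k l, P (i + k) (j + l) := by
    intro k l
    induction l with
    | zero => exact right k
    | succ l ih => exact up₂ (i + k) (j + l) (by omega) ih
  have left : ∀ k p q, N < max p q → P (p + k) q → P p q := by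
    intro k
    induction k with
    | zero => exact fun p q _ h ↦ h
    | succ k ih => exact fun p q hpq h ↦ ih p q hpq (down₁ (p + k) q (by omega) h)
  have down : ∀ l p q, N < max p q → P p (q + l) → P p q := by
    intro l
    induction l with
    | zero => exact fun p q _ h ↦ h
    | succ l ih => exact fun p q hpq h ↦ ih p q hpq (down₂ p (q + l) (by omega) h)
  apply left i p q hpq
  apply down j _ _ (by omega)
  rw [add_comm p, add_comm q]
  exact far p q

end ReillySemigroup

namespace IsReillyWithAdjoinedIdeal

open ReillySemigroup Set

/-! ### The cells are compact and open -/

variable {G : Type*} [Group G] {θ : G →* G} {S : Type*} [Semigroup S]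
  {ι : ReillySemigroup θ →ₙ* S} {I : Set S}

/-- The copy in `S` of `{i} × G × {j}`, an `ℋ`-class of the Reilly semigroup. -/
def cell (ι : ReillySemigroup θ →ₙ* S) (i j : ℕ) : Set S :=
  range fun g ↦ ι ⟨i, g, j⟩

/-- The union of the cells with both indices at most `N`. -/
def box (ι : ReillySemigroup θ →ₙ* S) (N : ℕ) : Set S :=
  ⋃ i ∈ Iic N, ⋃ j ∈ Iic N, cell ι i j

theorem image_units : ι '' {x | IsUnit x} = cell ι 0 0 := by
  ext s
  constructor
  · rintro ⟨⟨i, g, j⟩, hx, rfl⟩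
    obtain ⟨rfl, rfl⟩ := ReillySemigroup.isUnit_iff.1 hx
    exact ⟨g, rfl⟩
  · rintro ⟨g, rfl⟩
    exact ⟨_, ReillySemigroup.isUnit_iff.2 ⟨rfl, rfl⟩, rfl⟩

theorem notMem_ideal (hS : IsReillyWithAdjoinedIdeal θ ι I) (x : ReillySemigroup θ) : ι x ∉ I :=
  fun h ↦ disjoint_left.1 hS.disjoint ⟨x, rfl⟩ h

theorem mem_ideal_or (hS : IsReillyWithAdjoinedIdeal θ ι I) (s : S) :
    s ∈ I ∨ ∃ x, ι x = s := by
  have : s ∈ range ι ∪ I := hS.union_eq ▸ mem_univ s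
  exact this.symm

theorem apply_mem_cell_iff (hS : IsReillyWithAdjoinedIdeal θ ι I) {x : ReillySemigroup θ}
    {i j : ℕ} : ι x ∈ cell ι i j ↔ x.row = i ∧ x.col = j := by
  constructor
  · rintro ⟨g, hg⟩
    rw [← hS.injective hg]
    exact ⟨rfl, rfl⟩
  · rintro ⟨rfl, rfl⟩
    exact ⟨x.elt, rfl⟩

theorem apply_mem_box_iff (hS : IsReillyWithAdjoinedIdeal θ ι I) {x : ReillySemigroup θ}
    {N : ℕ} : ι x ∈ box ι N ↔ max x.row x.col ≤ N := by
  simp [box, hS.apply_mem_cell_iff]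

theorem notMem_cell_of_mem (hS : IsReillyWithAdjoinedIdeal θ ι I) {s : S} (hs : s ∈ I) (i j : ℕ) :
    s ∉ cell ι i j := by
  rintro ⟨g, rfl⟩
  exact hS.notMem_ideal _ hs

theorem notMem_box_of_mem (hS : IsReillyWithAdjoinedIdeal θ ι I) {s : S} (hs : s ∈ I) (N : ℕ) :
    s ∉ box ι N := by
  simp [box, hS.notMem_cell_of_mem hs]

theorem box_mono : Monotone (box ι) := fun _ _ h ↦
  biUnion_mono (Iic_subset_Iic.2 h) fun _ _ ↦ biUnion_subset_biUnion_left (Iic_subset_Iic.2 h)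

variable [TopologicalSpace S] [SeparatelyContinuousMul S]

theorem isCompact_cell (hG : IsCompact (cell ι 0 0)) (i j : ℕ) : IsCompact (cell ι i j) := by
  have hf : Continuous fun s : S ↦ ι ⟨i, 1, 0⟩ * s * ι ⟨0, 1, j⟩ :=
    (continuous_mul_const _).comp (continuous_const_mul _)
  convert hG.image hf
  rw [cell, cell, ← range_comp]
  congr 1
  ext g
  simp only [Function.comp, ← map_mul, translate_unit]

theorem isCompact_box (hG : IsCompact (cell ι 0 0)) (N : ℕ) : IsCompact (box ι N) :=
  (finite_Iic N).isCompact_biUnion fun i _ ↦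
    (finite_Iic N).isCompact_biUnion fun j _ ↦ isCompact_cell hG i j

variable [T2Space S]

theorem isOpen_cell_zero (hS : IsReillyWithAdjoinedIdeal θ ι I) (hI : IsCompact I) :
    IsOpen (cell ι 0 0) := by
  have h₁ : IsClosed {s : S | ι ⟨1, 1, 1⟩ * s = s} :=
    isClosed_eq (continuous_const_mul _) continuous_id
  have h₂ : IsClosed {s : S | s * ι ⟨1, 1, 1⟩ = s} :=
    isClosed_eq (continuous_mul_const _) continuous_id
  convert ((h₁.union h₂).union hI.isClosed).isOpen_compl
  ext s
  obtain hs | ⟨x, rfl⟩ := hS.mem_ideal_or s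
  · simp [hs, hS.notMem_cell_of_mem hs]
  · simp only [hS.apply_mem_cell_iff, mem_compl_iff, mem_union, mem_ofPred_eq, hS.notMem_ideal,
      or_false, ← map_mul, hS.injective.eq_iff,
      idempotent_mul_eq_self_iff, mul_idempotent_eq_self_iff]
    omega

theorem isOpen_cell (hS : IsReillyWithAdjoinedIdeal θ ι I) (hI : IsCompact I)
    (hG : IsCompact (cell ι 0 0)) (i j : ℕ) : IsOpen (cell ι i j) := by
  have hf : Continuous fun s : S ↦ ι ⟨0, 1, i⟩ * s * ι ⟨j, 1, 0⟩ :=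
    (continuous_mul_const _).comp (continuous_const_mul _)
  -- The preimage of the units consists of the cells `(i - k, j - k)`; those with `0 < k` are closed.
  have hC : IsClosed (⋃ k ∈ Iio i, ⋃ l ∈ Iio j, cell ι k l) :=
    (finite_Iio i).isClosed_biUnion fun k _ ↦
      (finite_Iio j).isClosed_biUnion fun l _ ↦ (isCompact_cell hG k l).isClosed
  convert ((hS.isOpen_cell_zero hI).preimage hf).sdiff hC
  ext s
  obtain hs | ⟨x, rfl⟩ := hS.mem_ideal_or s
  · have := (hS.isIdeal _ (hS.isIdeal s hs (ι ⟨0, 1, i⟩)).1 (ι ⟨j, 1, 0⟩)).2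
    simp [hS.notMem_cell_of_mem hs, hS.notMem_cell_of_mem this]
  · simp only [mem_sdiff, mem_preimage, ← map_mul, mem_iUnion, mem_Iio, hS.apply_mem_cell_iff,
      exists_prop]
    rw [← ReillySemigroup.isUnit_iff]
    constructor
    · rintro ⟨rfl, rfl⟩
      refine ⟨?_, by rintro ⟨k, hk, l, hl, h, -⟩; omega⟩
      rw [translate_to_unit, ReillySemigroup.isUnit_iff]
      exact ⟨rfl, rfl⟩
    · rintro ⟨h, h'⟩
      have := le_of_isUnit_translate h
      have : ¬ (x.row < i ∧ x.col < j) := fun h ↦ h' ⟨_, h.1, _, h.2, rfl, rfl⟩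
      omega

theorem isOpen_box (hS : IsReillyWithAdjoinedIdeal θ ι I) (hI : IsCompact I)
    (hG : IsCompact (cell ι 0 0)) (N : ℕ) : IsOpen (box ι N) :=
  isOpen_biUnion fun i _ ↦ isOpen_biUnion fun j _ ↦ hS.isOpen_cell hI hG i j

/-! ### Compact neighbourhoods of the ideal -/

/-- A compact set lies in a given neighbourhood of the ideal up to finitely many cells. -/
theorem exists_box_of_subset_open (hS : IsReillyWithAdjoinedIdeal θ ι I) (hI : IsCompact I)
    (hG : IsCompact (cell ι 0 0)) {K V : Set S} (hK : IsCompact K) (hV : IsOpen V) (hIV : I ⊆ V) :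
    ∃ N, K \ V ⊆ box ι N := by
  refine (hK.diff hV).elim_directed_cover (box ι) (hS.isOpen_box hI hG) ?_ box_mono.directed_le
  rintro s ⟨-, hs⟩
  obtain hs' | ⟨x, rfl⟩ := hS.mem_ideal_or s
  · exact absurd (hIV hs') hs
  · exact mem_iUnion.2 ⟨_, hS.apply_mem_box_iff.2 le_rfl⟩

/-- A continuous self-map preserving the ideal maps a compact neighbourhood of the ideal into
itself up to finitely many cells. -/
theorem exists_box_of_map (hS : IsReillyWithAdjoinedIdeal θ ι I) (hI : IsCompact I)
    (hG : IsCompact (cell ι 0 0)) {K : Set S} (hK : IsCompact K) (hIK : I ⊆ interior K)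
    {f : S → S} (hf : Continuous f) (hfI : MapsTo f I I) :
    ∃ N, ∀ x : ReillySemigroup θ, N < max x.row x.col → ι x ∈ K → f (ι x) ∈ K := by
  obtain ⟨N, hN⟩ := hS.exists_box_of_subset_open hI hG hK (isOpen_interior.preimage hf)
    fun s hs ↦ hIK (hfI hs)
  refine ⟨N, fun x hx hxK ↦ ?_⟩
  by_contra h
  have := hS.apply_mem_box_iff.1 (hN ⟨hxK, fun h' ↦ h (interior_subset h')⟩)
  omega

theorem exists_box_of_mul_left (hS : IsReillyWithAdjoinedIdeal θ ι I) (hI : IsCompact I)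
    (hG : IsCompact (cell ι 0 0)) {K : Set S} (hK : IsCompact K) (hIK : I ⊆ interior K)
    (a : ReillySemigroup θ) :
    ∃ N, ∀ x : ReillySemigroup θ, N < max x.row x.col → ι x ∈ K → ι (a * x) ∈ K := by
  simpa only [map_mul] using hS.exists_box_of_map hI hG hK hIK (continuous_const_mul (ι a))
    fun s hs ↦ (hS.isIdeal s hs _).1

theorem exists_box_of_mul_right (hS : IsReillyWithAdjoinedIdeal θ ι I) (hI : IsCompact I)
    (hG : IsCompact (cell ι 0 0)) {K : Set S} (hK : IsCompact K) (hIK : I ⊆ interior K)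
    (a : ReillySemigroup θ) :
    ∃ N, ∀ x : ReillySemigroup θ, N < max x.row x.col → ι x ∈ K → ι (x * a) ∈ K := by
  simpa only [map_mul] using hS.exists_box_of_map hI hG hK hIK (continuous_mul_const (ι a))
    fun s hs ↦ (hS.isIdeal s hs _).2

/-- Outside a suitable box, whether `(i, g, j)` lies in a compact neighbourhood of the ideal depends
on `g` only. -/
theorem exists_box_forall_mem (hS : IsReillyWithAdjoinedIdeal θ ι I) (hI : IsCompact I)
    (hG : IsCompact (cell ι 0 0)) {K : Set S} (hK : IsCompact K) (hIK : I ⊆ interior K) :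
    ∃ N, ∀ (g : G) (i j : ℕ), N < max i j → ι ⟨i, g, j⟩ ∈ K →
      ∀ p q, N < max p q → ι ⟨p, g, q⟩ ∈ K := by
  obtain ⟨N₁, h₁⟩ := hS.exists_box_of_mul_left hI hG hK hIK ⟨1, 1, 0⟩
  obtain ⟨N₂, h₂⟩ := hS.exists_box_of_mul_left hI hG hK hIK ⟨0, 1, 1⟩
  obtain ⟨N₃, h₃⟩ := hS.exists_box_of_mul_right hI hG hK hIK ⟨0, 1, 1⟩
  obtain ⟨N₄, h₄⟩ := hS.exists_box_of_mul_right hI hG hK hIK ⟨1, 1, 0⟩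
  refine ⟨max (max N₁ N₂) (max N₃ N₄), fun g i j hij h ↦
    forall_outside_box (P := fun p q ↦ ι ⟨p, g, q⟩ ∈ K) ?_ ?_ ?_ ?_ hij h⟩
  · intro p q hpq h
    simpa only [raise_row] using h₁ ⟨p, g, q⟩ (by dsimp only; omega) h
  · intro p q hpq h
    simpa only [lower_row] using h₂ ⟨p + 1, g, q⟩ (by dsimp only; omega) h
  · intro p q hpq h
    simpa only [raise_col] using h₃ ⟨p, g, q⟩ (by dsimp only; omega) h
  · intro p q hpq h
    simpa only [lower_col] using h₄ ⟨p, g, q + 1⟩ (by dsimp only; omega) h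

/-- If the ideal is not open, no neighbourhood of it avoids all but finitely many cells. -/
theorem exists_mem_outside_box (hS : IsReillyWithAdjoinedIdeal θ ι I)
    (hG : IsCompact (cell ι 0 0)) (hIo : ¬ IsOpen I) {K : Set S} (hIK : I ⊆ interior K) (N : ℕ) :
    ∃ x : ReillySemigroup θ, N < max x.row x.col ∧ ι x ∈ K := by
  by_contra! h
  apply hIo
  convert isOpen_interior (s := K) |>.sdiff (isCompact_box hG N).isClosed
  ext s
  constructor
  · exact fun hs ↦ ⟨hIK hs, hS.notMem_box_of_mem hs N⟩
  · rintro ⟨hsK, hsN⟩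
    obtain hs | ⟨x, rfl⟩ := hS.mem_ideal_or s
    · exact hs
    · rw [hS.apply_mem_box_iff, not_le] at hsN
      exact absurd (interior_subset hsK) (h x hsN)

end IsReillyWithAdjoinedIdeal

/-! ### The dichotomy -/

open IsReillyWithAdjoinedIdeal in
theorem theorem3p16 {G : Type*} [Group G] (θ : G →* G)
    {S : Type*} [Semigroup S] [TopologicalSpace S] [T2Space S] [LocallyCompactSpace S]
    [SeparatelyContinuousMul S]
    (ι : ReillySemigroup θ →ₙ* S) (I : Set S) (hS : IsReillyWithAdjoinedIdeal θ ι I)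
    (hG : IsCompact (ι '' {x : ReillySemigroup θ | IsUnit x}))
    (hI : IsCompact I) :
    CompactSpace S ∨ IsOpen I := by
  rw [image_units] at hG
  refine or_iff_not_imp_right.2 fun hIo ↦ ?_
  obtain ⟨K, hK, hIK⟩ := exists_compact_superset hI
  obtain ⟨N, hN⟩ := hS.exists_box_forall_mem hI hG hK hIK
  obtain ⟨⟨i, g, j⟩, hij, hg⟩ := hS.exists_mem_outside_box hG hIo hIK N
  have hall : ∀ (k : G) (p q : ℕ), N < max p q → ι ⟨p, k, q⟩ ∈ K := by
    intro k
    obtain ⟨M, hM⟩ := hS.exists_box_of_mul_left hI hG hK hIK ⟨0, k * g⁻¹, 0⟩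
    -- In row `0` a unit acts on the group component without a power of `θ`, so `g` reaches `k`.
    have h := hM ⟨0, g, max M N + 1⟩ (by dsimp only; omega) (hN g i j hij hg _ _ (by omega))
    rw [ReillySemigroup.unit_mul_of_row_zero, inv_mul_cancel_right] at h
    exact hN k _ _ (by omega) h
  refine ⟨(hK.union (isCompact_box hG N)).of_isClosed_subset isClosed_univ fun s _ ↦ ?_⟩
  obtain hs | ⟨x, rfl⟩ := hS.mem_ideal_or s
  · exact Or.inl (interior_subset (hIK hs))
  · by_cases hx : N < max x.row x.col
    · exact Or.inl (hall _ _ _ hx)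
    · exact Or.inr (hS.apply_mem_box_iff.2 (not_lt.1 hx))
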